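/- Let $\mathbb K$ be a field of characteristic zero. For a $\mathbb K$-vector space $V$ and a linear map $f:V\to V$, let $T(V,f)$ be the tensor algebra $T(V)$ (the span of words with letters in $V$, with empty word $\emptyset$), equipped with the shuffle product $\shuffle$ (bilinear, with unit $\emptyset$, and $xu\shuffle yv=x(u\shuffle yv)+y(xu\shuffle v)$ for $x,y\in V$, $u,v\in T(V)$) and with the bilinear product $\bullet$ defined by $$\emptyset\bullet w'=0,\qquad xw\bullet w'=x(w\bullet w')+f(x)(w\shuffle w')\qquad (x\in V,\ w,w'\in T(V)).$$ A subset $S\subseteq T(V)$ generates $T(V,f)$ as a pre-Lie algebra if $T(V)$ is the only linear subspace containing $S$ and stable under $\bullet$; it generates $T(V,f)$ as a Com-Pre-Lie algebra if $T(V)$ is the only linear subspace containing $S$ and stable under both $\shuffle$ and $\bullet$ (subalgebras are not required to contain $\emptyset$). A generating set is minimal if no proper subset of it is generating. A word over a totally ordered alphabet is Lyndon if it is nonempty and lexicographically strictly smaller than each of its proper nonempty suffixes. (A) Let $D$ be a totally ordered set, let $V_D$ be the vector space with basis the biletters $\binom{k}{d}$, $k\in\mathbb N=\{0,1,2,\ldots\}$,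 $d\in D$, and let $f_D:V_D\to V_D$ be the linear map with $f_D\binom{k}{d}=\binom{k+1}{d}$; order the biletters $\binom{0}{d}$ as $D$. 1. The set of all words (including $\emptyset$) in the biletters $\binom{0}{d}$, $d\in D$, is a minimal generating set of the pre-Lie algebra $T(V_D,f_D)$. 2. The set consisting of $\emptyset$ and the Lyndon words in the biletters $\binom{0}{d}$, $d\in D$, is a minimal generating set of the Com-Pre-Lie algebra $T(V_D,f_D)$. (B) Let $V$ be a $\mathbb K$-vector space, $g:V\to V$ a linear map and $W\subseteq V$ a linear subspace such that $V=\sum_{n=0}^{\infty}g^n(W)$. 1. $T(V,g)$ is generated, as a pre-Lie algebra, by $T(W)\subseteq T(V)$. 2. For every basis $(w_d)_{d\in D}$ of $W$ indexed by a totally ordered set $D$, $T(V,g)$ is generated, as a Com-Pre-Lie algebra, by $\emptyset$ and the Lyndon words in the letters $w_d$, $d\in D$. -/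

import Mathlib

open scoped TensorProduct

noncomputable section

namespace ComPreLie

section Products

variable {K : Type*} [Field K] {V : Type*} [AddCommGroup V] [Module K V]

/-- Left multiplication by the letter `y` on pairs (word, deconcatenation of that word):
`(v, δ) ↦ (yv, ∅ ⊗ yv + (y ⊗ ∅) δ)`. -/
def deconcStep : V →ₗ[K] Module.End K
    (TensorAlgebra K V × (TensorAlgebra K V ⊗[K] TensorAlgebra K V)) where
  toFun y :=
    { toFun := fun p =>
        (TensorAlgebra.ι K y * p.1,
          (1 : TensorAlgebra K V) ⊗ₜ[K] (TensorAlgebra.ι K y * p.1) +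
            (TensorAlgebra.ι K y ⊗ₜ[K] (1 : TensorAlgebra K V)) * p.2)
      map_add' := fun p q => by
        ext <;> simp [mul_add, TensorProduct.tmul_add]
        abel
      map_smul' := fun c p => by
        ext <;> simp }
  map_add' x y := by
    refine LinearMap.ext fun p => ?_
    ext <;> simp [add_mul, TensorProduct.tmul_add, TensorProduct.add_tmul]
    abel
  map_smul' c y := by
    refine LinearMap.ext fun p => ?_
    ext <;> simp [← TensorProduct.smul_tmul']

/-- The deconcatenation coproduct of `T(V)`:
`x₁…xₙ ↦ ∑ᵢ x₁…xᵢ ⊗ xᵢ₊₁…xₙ`, the sum being over `0 ≤ i ≤ n`. -/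
def deconc : TensorAlgebra K V →ₗ[K] TensorAlgebra K V ⊗[K] TensorAlgebra K V :=
  LinearMap.snd K _ _ ∘ₗ LinearMap.applyₗ (1, 1 ⊗ₜ[K] 1) ∘ₗ
    (TensorAlgebra.lift K (deconcStep (K := K) (V := V))).toLinearMap

/-- The operator sending `u ⧢ ·` to `xu ⧢ ·`, through
`xu ⧢ b = ∑ b' x (u ⧢ b'')`, the sum being over all factorizations `b = b'b''`. -/
def shuffleStep : V →ₗ[K] Module.End K (TensorAlgebra K V →ₗ[K] TensorAlgebra K V) where
  toFun x :=
    { toFun := fun s =>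
        LinearMap.mul' K (TensorAlgebra K V) ∘ₗ
          LinearMap.lTensor _ (LinearMap.mulLeft K (TensorAlgebra.ι K x) ∘ₗ s) ∘ₗ deconc
      map_add' := fun s t => by
        simp [LinearMap.comp_add, LinearMap.add_comp]
      map_smul' := fun c s => by
        simp [LinearMap.comp_smul, LinearMap.smul_comp] }
  map_add' x y := by
    refine LinearMap.ext fun s => ?_
    have h : LinearMap.mulLeft K (TensorAlgebra.ι K (x + y)) =
      LinearMap.mulLeft K (TensorAlgebra.ι K x) + LinearMap.mulLeft K (TensorAlgebra.ι K y) := by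
        ext; simp [add_mul]
    simp only [LinearMap.coe_mk, AddHom.coe_mk, LinearMap.add_apply, h, LinearMap.comp_add,
      LinearMap.add_comp, LinearMap.lTensor_add]
  map_smul' c x := by
    refine LinearMap.ext fun s => ?_
    have h : LinearMap.mulLeft K (TensorAlgebra.ι K (c • x)) =
      c • LinearMap.mulLeft K (TensorAlgebra.ι K x) := by
        ext; simp
    simp only [LinearMap.coe_mk, AddHom.coe_mk, LinearMap.smul_apply, h, LinearMap.comp_smul,
      LinearMap.smul_comp, LinearMap.lTensor_smul, RingHom.id_apply]

/-- The shuffle product of `T(V)`; see `one_shuffle`, `shuffle_one` and `ι_mul_shuffle_ι_mul`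
for the usual recursion. -/
def shuffle : TensorAlgebra K V →ₗ[K] TensorAlgebra K V →ₗ[K] TensorAlgebra K V :=
  LinearMap.applyₗ LinearMap.id ∘ₗ
    (TensorAlgebra.lift K (shuffleStep (K := K) (V := V))).toLinearMap

/-- Left multiplication by the letter `x` on pairs `(w, w • ·)`:
`(w, β) ↦ (xw, w' ↦ x β(w') + f(x)(w ⧢ w'))`. -/
def bulletStep (f : V →ₗ[K] V) : V →ₗ[K] Module.End K
    (TensorAlgebra K V × (TensorAlgebra K V →ₗ[K] TensorAlgebra K V)) where
  toFun x :=
    { toFun := fun p =>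
        (TensorAlgebra.ι K x * p.1,
          LinearMap.mulLeft K (TensorAlgebra.ι K x) ∘ₗ p.2 +
            LinearMap.mulLeft K (TensorAlgebra.ι K (f x)) ∘ₗ shuffle p.1)
      map_add' := fun p q => by
        refine Prod.ext ?_ (LinearMap.ext fun w => ?_)
        · simp [mul_add]
        · simp [mul_add]
          abel
      map_smul' := fun c p => by
        refine Prod.ext ?_ (LinearMap.ext fun w => ?_) <;> simp }
  map_add' x y := by
    refine LinearMap.ext fun p => Prod.ext ?_ (LinearMap.ext fun w => ?_)
    · simp [add_mul]
    · simp [add_mul]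
      abel
  map_smul' c x := by
    refine LinearMap.ext fun p => Prod.ext ?_ (LinearMap.ext fun w => ?_) <;> simp

/-- The pre-Lie product `•` of `T(V, f)`; see `one_bullet` and `ι_mul_bullet` for the recursion
`∅ • w' = 0`, `xw • w' = x(w • w') + f(x)(w ⧢ w')`. -/
def bullet (f : V →ₗ[K] V) :
    TensorAlgebra K V →ₗ[K] TensorAlgebra K V →ₗ[K] TensorAlgebra K V :=
  LinearMap.snd K _ _ ∘ₗ LinearMap.applyₗ (1, 0) ∘ₗ
    (TensorAlgebra.lift K (bulletStep f)).toLinearMap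

/-! The recursions satisfied by these maps. -/

theorem left_induction {C : TensorAlgebra K V → Prop} (h1 : C 1)
    (hadd : ∀ a b, C a → C b → C (a + b)) (hsmul : ∀ (c : K) a, C a → C (c • a))
    (hmul : ∀ x a, C a → C (TensorAlgebra.ι K x * a)) (a : TensorAlgebra K V) : C a := by
  have key : ∀ a b : TensorAlgebra K V, C b → C (a * b) := by
    intro a
    induction a using TensorAlgebra.induction with
    | algebraMap r => intro b hb; rw [← Algebra.smul_def]; exact hsmul r b hb
    | ι x => intro b hb; exact hmul x b hb
    | mul a a' iha iha' => intro b hb; rw [mul_assoc]; exact iha _ (iha' _ hb)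
    | add a a' iha iha' => intro b hb; rw [add_mul]; exact hadd _ _ (iha _ hb) (iha' _ hb)
  simpa using key a 1 h1

@[simp]
theorem deconc_one : deconc (1 : TensorAlgebra K V) = 1 ⊗ₜ[K] 1 := by
  simp [deconc]

theorem deconc_ι_mul (y : V) (v : TensorAlgebra K V) :
    deconc (TensorAlgebra.ι K y * v) =
      1 ⊗ₜ[K] (TensorAlgebra.ι K y * v) + (TensorAlgebra.ι K y ⊗ₜ[K] 1) * deconc v := by
  have h : ∀ v : TensorAlgebra K V,
      (TensorAlgebra.lift K (deconcStep (K := K) (V := V)) v (1, 1 ⊗ₜ[K] 1)).1 = v := by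
    intro v
    induction v using left_induction with
    | h1 => simp
    | hadd a b ha hb => simp [ha, hb]
    | hsmul c a ha => simp [ha]
    | hmul x a ha =>
      rw [map_mul, TensorAlgebra.lift_ι_apply, Module.End.mul_apply]
      exact congrArg (TensorAlgebra.ι K x * ·) ha
  change (TensorAlgebra.lift K deconcStep (TensorAlgebra.ι K y * v) (1, 1 ⊗ₜ[K] 1)).2 = _
  rw [map_mul, TensorAlgebra.lift_ι_apply, Module.End.mul_apply]
  change 1 ⊗ₜ[K] (TensorAlgebra.ι K y * _) + _ = _
  rw [h v]
  rfl

@[simp]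
theorem one_shuffle (b : TensorAlgebra K V) : shuffle 1 b = b := by
  simp [shuffle]

theorem ι_mul_shuffle (x : V) (u b : TensorAlgebra K V) :
    shuffle (TensorAlgebra.ι K x * u) b =
      LinearMap.mul' K (TensorAlgebra K V)
        (LinearMap.lTensor _ (LinearMap.mulLeft K (TensorAlgebra.ι K x) ∘ₗ shuffle u)
          (deconc b)) := by
  simp [shuffle, shuffleStep]

@[simp]
theorem shuffle_one (a : TensorAlgebra K V) : shuffle a 1 = a := by
  induction a using left_induction with
  | h1 => simp
  | hadd a b ha hb => simp [ha, hb]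
  | hsmul c a ha => simp [ha]
  | hmul x a ha => simp [ι_mul_shuffle, ha]

theorem ι_mul_shuffle_ι_mul (x y : V) (u v : TensorAlgebra K V) :
    shuffle (TensorAlgebra.ι K x * u) (TensorAlgebra.ι K y * v) =
      TensorAlgebra.ι K x * shuffle u (TensorAlgebra.ι K y * v) +
        TensorAlgebra.ι K y * shuffle (TensorAlgebra.ι K x * u) v := by
  rw [ι_mul_shuffle, ι_mul_shuffle, deconc_ι_mul]
  simp only [map_add, LinearMap.lTensor_tmul, LinearMap.mul'_apply, LinearMap.comp_apply,
    LinearMap.mulLeft_apply, one_mul]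
  congr 1
  induction deconc v using TensorProduct.induction_on with
  | zero => simp
  | tmul p q => simp [mul_assoc]
  | add p q hp hq => simp [mul_add, hp, hq]

@[simp]
theorem one_bullet (f : V →ₗ[K] V) (b : TensorAlgebra K V) : bullet f 1 b = 0 := by
  simp [bullet]

theorem ι_mul_bullet (f : V →ₗ[K] V) (x : V) (w w' : TensorAlgebra K V) :
    bullet f (TensorAlgebra.ι K x * w) w' =
      TensorAlgebra.ι K x * bullet f w w' + TensorAlgebra.ι K (f x) * shuffle w w' := by
  have h : ∀ v : TensorAlgebra K V,
      (TensorAlgebra.lift K (bulletStep f) v (1, 0)).1 = v := by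
    intro v
    induction v using left_induction with
    | h1 => simp
    | hadd a b ha hb => simp [ha, hb]
    | hsmul c a ha => simp [ha]
    | hmul x a ha =>
      rw [map_mul, TensorAlgebra.lift_ι_apply, Module.End.mul_apply]
      exact congrArg (TensorAlgebra.ι K x * ·) ha
  change (TensorAlgebra.lift K (bulletStep f) (TensorAlgebra.ι K x * w) (1, 0)).2 w' = _
  rw [map_mul, TensorAlgebra.lift_ι_apply, Module.End.mul_apply]
  change _ + TensorAlgebra.ι K (f x) * shuffle _ w' = _
  rw [h w]
  rfl

end Products

section Generation

variable {K : Type*} [Field K] {V : Type*} [AddCommGroup V] [Module K V]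

/-- The pre-Lie subalgebra of `T(V, f)` generated by `S`: the smallest linear subspace
containing `S` and stable under `•`. -/
def preLieAdjoin (f : V →ₗ[K] V) (S : Set (TensorAlgebra K V)) :
    Submodule K (TensorAlgebra K V) :=
  sInf {A | S ⊆ A ∧ ∀ a ∈ A, ∀ b ∈ A, bullet f a b ∈ A}

/-- The Com-Pre-Lie subalgebra of `T(V, f)` generated by `S`: the smallest linear subspace
containing `S` and stable under `⧢` and `•`. It is not required to contain `∅`. -/
def comPreLieAdjoin (f : V →ₗ[K] V) (S : Set (TensorAlgebra K V)) :
    Submodule K (TensorAlgebra K V) :=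
  sInf {A | S ⊆ A ∧ (∀ a ∈ A, ∀ b ∈ A, shuffle a b ∈ A) ∧ ∀ a ∈ A, ∀ b ∈ A, bullet f a b ∈ A}

/-- `T(W)`, seen inside `T(V)`. -/
def tensorSubspace (W : Submodule K V) : Submodule K (TensorAlgebra K V) :=
  LinearMap.range
    (TensorAlgebra.lift K (TensorAlgebra.ι K ∘ₗ W.subtype)).toLinearMap

/-- The element `x_{d₁}…x_{dₙ}` of `T(V)` given by a word `d₁…dₙ` and a family `x` of vectors. -/
def word {D : Type*} (x : D → V) (l : List D) : TensorAlgebra K V :=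
  (l.map fun d => TensorAlgebra.ι K (x d)).prod

/-- The set of all words in the letters `x d`. -/
def words (K : Type*) [Field K] {V : Type*} [AddCommGroup V] [Module K V] {D : Type*}
    (x : D → V) : Set (TensorAlgebra K V) :=
  Set.range (word x)

/-- A Lyndon word: a nonempty word that is lexicographically strictly smaller than each of its
proper nonempty suffixes. -/
def IsLyndon {D : Type*} [LinearOrder D] (l : List D) : Prop :=
  l ≠ [] ∧ ∀ u v : List D, u ≠ [] → v ≠ [] → l = u ++ v → l < v

/-- The empty word together with the Lyndon words in the letters `x d`. -/
def emptyAndLyndonWords (K : Type*) [Field K] {V : Type*} [AddCommGroup V] [Module K V]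
    {D : Type*} [LinearOrder D] (x : D → V) : Set (TensorAlgebra K V) :=
  insert 1 (word x '' {l | IsLyndon l})

end Generation

section Biletters

/-- `V_D`, the vector space with basis the biletters `(k, d)`, `k ∈ ℕ`, `d ∈ D`. -/
abbrev BiSpace (K : Type*) [Field K] (D : Type*) : Type _ := (ℕ × D) →₀ K

/-- `f_D`, the endomorphism of `V_D` sending `(k, d)` to `(k + 1, d)`. -/
def biShift (K : Type*) [Field K] (D : Type*) : BiSpace K D →ₗ[K] BiSpace K D :=
  Finsupp.lmapDomain K K fun p => (p.1 + 1, p.2)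

/-- The biletter `(0, d)`. -/
def biletterZero (K : Type*) [Field K] {D : Type*} (d : D) : BiSpace K D :=
  Finsupp.single (0, d) 1

end Biletters

end ComPreLie

end

noncomputable section

namespace ComPreLie

/-! ### Shuffles of words and their multiplicities. -/

section Combinatorics

variable {D : Type*}

/-! Three mechanisms carry the result. Generation under `•`: call `k` the exponent of the letter
`(k, e)`, which stands for the `k`-th iterate of the map applied to `e`. If all letters of `u` have
exponent 0, then `u(k,e) • l'` is `u(k+1,e)l'` plus words of the same total exponent in which an
earlier letter of `u` has been raised. A double induction, on total exponent and on the length of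
the initial block of exponent 0, yields every word (`word_mem_of_bullet_closed`). It uses only that
the letters span, so it serves (A) and (B) alike. Generation under `⧢`: among the shuffles of a
nonincreasing sequence of Lyndon words, the concatenation is the largest
(`IsLyndonSeq.le_of_mem_shuffleAll`). Every word has exactly one such factorization, so shuffle
products of Lyndon sequences are triangular in the words, with positive integers on the diagonal. In
characteristic zero this gives Radford's theorem (`word_mem_of_lyndon`) and an independence
statement (`word_flatten_notMem_lyndonSpanNe`). Minimality: the projection of `V_D` on the letters
of exponent 0 kills the image of `f_D`. The induced map respects `⧢` and annihilates every `•`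
product (`tensorMap_bullet`), so a generating set must already generate linearly, respectively under
`⧢`, the words in exponent 0. Linear independence of words, respectively of Lyndon products, forbids
dropping a generator. -/

/-- The list, with multiplicities, of all shuffles of two words. -/
def shuffles : List D → List D → List (List D)
  | [], v => [v]
  | x :: u, [] => [x :: u]
  | x :: u, y :: v =>
    (shuffles u (y :: v)).map (x :: ·) ++ (shuffles (x :: u) v).map (y :: ·)
termination_by u v => u.length + v.length

@[simp]
theorem shuffles_nil_left (v : List D) : shuffles [] v = [v] := by
  rw [shuffles]

@[simp]
theorem shuffles_nil_right (u : List D) : shuffles u [] = [u] := by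
  cases u <;> rw [shuffles]

theorem shuffles_cons_cons (x y : D) (u v : List D) :
    shuffles (x :: u) (y :: v) =
      (shuffles u (y :: v)).map (x :: ·) ++ (shuffles (x :: u) v).map (y :: ·) := by
  rw [shuffles]

theorem mem_shuffles_cons_cons {x y : D} {u v w : List D} :
    w ∈ shuffles (x :: u) (y :: v) ↔
      (∃ w' ∈ shuffles u (y :: v), w = x :: w') ∨ ∃ w' ∈ shuffles (x :: u) v, w = y :: w' := by
  simp only [shuffles_cons_cons, List.mem_append, List.mem_map, eq_comm]

theorem cons_mem_shuffles_left (x : D) {u v w : List D} (h : w ∈ shuffles u v) :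
    x :: w ∈ shuffles (x :: u) v := by
  cases v with
  | nil => simpa using h
  | cons y v => exact mem_shuffles_cons_cons.2 (Or.inl ⟨w, h, rfl⟩)

theorem cons_mem_shuffles_right (y : D) {u v w : List D} (h : w ∈ shuffles u v) :
    y :: w ∈ shuffles u (y :: v) := by
  cases u with
  | nil => simpa using h
  | cons x u => exact mem_shuffles_cons_cons.2 (Or.inr ⟨w, h, rfl⟩)

theorem append_mem_shuffles (u v : List D) : u ++ v ∈ shuffles u v := by
  induction u with
  | nil => simp
  | cons x u ih => exact cons_mem_shuffles_left x ih

theorem append_mem_shuffles_swap (u v : List D) : v ++ u ∈ shuffles u v := by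
  induction v with
  | nil => simp
  | cons y v ih => exact cons_mem_shuffles_right y ih

theorem perm_of_mem_shuffles {u v w : List D} (h : w ∈ shuffles u v) : w.Perm (u ++ v) := by
  induction w generalizing u v with
  | nil =>
    cases u with
    | nil => simp_all
    | cons x u =>
      cases v with
      | nil => simp at h
      | cons y v => simp [mem_shuffles_cons_cons] at h
  | cons z w ih =>
    cases u with
    | nil => simp_all
    | cons x u =>
      cases v with
      | nil => simp_all
      | cons y v =>
        rcases mem_shuffles_cons_cons.1 h with ⟨w', hw', e⟩ | ⟨w', hw', e⟩
        · cases e; exact (ih hw').cons _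
        · cases e; exact ((ih hw').cons _).trans List.perm_middle.symm

/-! ### Lexicographic order and the largest shuffle. -/

variable [LinearOrder D]

theorem empty_le (u : List D) : [] ≤ u :=
  not_lt.1 (List.not_lt_nil u)

theorem cons_le_cons_self_iff {x : D} {u v : List D} : x :: u ≤ x :: v ↔ u ≤ v := by
  simp [← not_lt]

theorem cons_le_cons_of_lt {x y : D} (h : x < y) (u v : List D) : x :: u ≤ y :: v :=
  le_of_lt (List.cons_lt_cons_iff.2 (Or.inl h))

theorem append_lt_append_left_iff {p u v : List D} : p ++ u < p ++ v ↔ u < v := by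
  induction p with
  | nil => rfl
  | cons x p ih => simpa using ih

theorem append_le_append_left_iff {p u v : List D} : p ++ u ≤ p ++ v ↔ u ≤ v := by
  rw [← not_lt, append_lt_append_left_iff, not_lt]

theorem le_append_self (u v : List D) : u ≤ u ++ v := by
  simpa using (append_le_append_left_iff (p := u) (u := []) (v := v)).2 (empty_le v)

/-- The comparison is decided at a letter where the words differ, so what follows does not matter.
-/
theorem append_lt_of_lt_of_not_prefix {u v : List D} (h : u < v) (hp : ¬ u <+: v)
    (t : List D) : u ++ t < v := by
  induction u generalizing v with
  | nil => simp at hp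
  | cons x u ih =>
    cases v with
    | nil => simp at h
    | cons y v =>
      rw [List.cons_append, List.cons_lt_cons_iff]
      rcases List.cons_lt_cons_iff.1 h with h' | ⟨rfl, h'⟩
      · exact Or.inl h'
      · exact Or.inr ⟨rfl, ih h' fun hp' => hp (by simpa using hp')⟩

/-- Exchange lemma: if `v ≤ a`, a prefix `p` of the first word may be moved to the second one
without decreasing the largest shuffle. -/
theorem exists_le_mem_shuffles_append {a v p w : List D}
    (h : v ≤ a ∨ ∃ t, v = a ++ t ∧ ∀ w ∈ shuffles (p ++ a) t, w ≤ p ++ (a ++ t))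
    (hw : w ∈ shuffles (p ++ a) v) : ∃ w' ∈ shuffles a (p ++ v), w ≤ w' := by
  induction w generalizing a v p with
  | nil =>
    exact ⟨p ++ v ++ a, append_mem_shuffles_swap _ _, empty_le _⟩
  | cons c w ih =>
    cases p with
    | nil => exact ⟨_, hw, le_rfl⟩
    | cons x p =>
      cases v with
      | nil =>
        refine ⟨_, append_mem_shuffles_swap _ _, ?_⟩
        simp at hw
        simp [hw]
      | cons y v =>
        rcases mem_shuffles_cons_cons.1 hw with ⟨w', hw', e⟩ | ⟨w', hw', e⟩
        · cases e
          obtain ⟨w', hw', hle⟩ := ih (a := a) (v := y :: v) (p := p) (by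
            refine h.imp id ?_
            rintro ⟨t, ht, H⟩
            refine ⟨t, ht, fun w hw => ?_⟩
            exact cons_le_cons_self_iff.1 (H _ (cons_mem_shuffles_left c hw))) hw'
          exact ⟨_, cons_mem_shuffles_right c hw', cons_le_cons_self_iff.2 hle⟩
        -- The first letter `c` now comes from the second word; it is compared with the first letter
        -- of `a`.
        · cases e
          cases a with
          | nil =>
            rcases h with h | ⟨t, ht, H⟩
            · exact absurd h (not_le.2 (List.nil_lt_cons _ _))
            · refine ⟨_, append_mem_shuffles _ _, ?_⟩
              have := H (c :: w) (by rw [List.nil_append] at ht; rw [← ht]; exact hw)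
              rw [← ht] at this
              simpa using this
          | cons z a =>
            have hcz : c < z ∨ c = z ∧ (v ≤ a ∨ ∃ t, v = a ++ t ∧
                ∀ w ∈ shuffles ((x :: p ++ [c]) ++ a) t, w ≤ (x :: p ++ [c]) ++ (a ++ t)) := by
              rcases h with h | ⟨t, ht, H⟩
              · rcases h.lt_or_eq with h | h
                · rcases List.cons_lt_cons_iff.1 h with h | ⟨h, h'⟩
                  · exact Or.inl h
                  · exact Or.inr ⟨h, Or.inl h'.le⟩
                · cases h; exact Or.inr ⟨rfl, Or.inl le_rfl⟩
              · cases ht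
                exact Or.inr ⟨rfl, Or.inr ⟨t, rfl, by simpa using H⟩⟩
            rcases hcz with hcz | ⟨rfl, hcz⟩
            · exact ⟨_, append_mem_shuffles _ _, cons_le_cons_of_lt hcz _ _⟩
            -- Equal first letters are exchanged: `c` is taken from `a` instead, and the copy of `c`
            -- still unread in the first word joins the prefix to be moved.
            · obtain ⟨w', hw', hle⟩ := ih (p := x :: p ++ [c]) hcz (by simpa using hw')
              refine ⟨c :: w', cons_mem_shuffles_left c (by simpa using hw'),
                cons_le_cons_self_iff.2 hle⟩

/-- Replays the same choices of letters until `v` and `v'` first differ, then takes the larger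
letter. Equal lengths exclude the case of a proper prefix. -/
theorem exists_lt_mem_shuffles {u v v' w : List D} (hlen : v.length = v'.length) (h : v < v')
    (hw : w ∈ shuffles u v) : ∃ w' ∈ shuffles u v', w < w' := by
  induction w generalizing u v v' with
  | nil =>
    have := (perm_of_mem_shuffles hw).length_eq
    have hv : v = [] := by
      apply List.eq_nil_of_length_eq_zero
      have h0 : u.length + v.length = 0 := by simpa using this.symm
      omega
    subst hv
    have : v' = [] := List.eq_nil_of_length_eq_zero (by simpa using hlen.symm)
    simp [this] at h
  | cons c w ih =>
    cases v with
    | nil =>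
      have : v' = [] := List.eq_nil_of_length_eq_zero (by simpa using hlen.symm)
      simp [this] at h
    | cons y v =>
      cases v' with
      | nil => simp at hlen
      | cons y' v' =>
        have main : ∀ w', (c :: w') = (y :: w') → w' = w → w' ∈ shuffles u v →
            ∃ w'' ∈ shuffles u (y' :: v'), c :: w < w'' := by
          rintro w' e rfl hw'
          cases e
          rcases List.cons_lt_cons_iff.1 h with h' | ⟨rfl, h'⟩
          · exact ⟨_, append_mem_shuffles_swap _ _, List.cons_lt_cons_iff.2 (Or.inl h')⟩
          · obtain ⟨w'', h1, h2⟩ := ih (by simpa using hlen) h' hw'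
            exact ⟨_, cons_mem_shuffles_right _ h1, by simpa using h2⟩
        cases u with
        | nil =>
          rw [shuffles_nil_left, List.mem_singleton] at hw
          cases hw
          exact main _ rfl rfl (by simp)
        | cons x u =>
          rcases mem_shuffles_cons_cons.1 hw with ⟨w', hw', e⟩ | ⟨w', hw', e⟩
          · cases e
            obtain ⟨w'', h1, h2⟩ := ih hlen h hw'
            exact ⟨_, cons_mem_shuffles_left _ h1, by simpa using h2⟩
          · cases e
            exact main _ rfl rfl hw'

/-- Words not larger than a Lyndon word `l` concatenate to a word not larger than any proper
suffix of `l`. -/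
theorem IsLyndon.flatten_le_suffix {l : List D} (hl : IsLyndon l) {m : List (List D)}
    (hm : ∀ a ∈ m, a ≤ l) {p s : List D} (hp : p ≠ []) (hs : s ≠ []) (h : l = p ++ s) :
    m.flatten ≤ s := by
  induction m generalizing p s with
  | nil => exact empty_le _
  | cons a m ih =>
    have has : a < s := (hm a (by simp)).trans_lt (hl.2 p s hp hs h)
    rw [List.flatten_cons]
    by_cases hpre : a <+: s
    · obtain ⟨t, rfl⟩ := hpre
      refine append_le_append_left_iff.2 (ih (fun b hb => hm b (by simp [hb])) (p := p ++ a)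
        (by simp [hp]) ?_ (by simp [h]))
      rintro rfl
      simp at has
    · exact (append_lt_of_lt_of_not_prefix has hpre _).le

theorem IsLyndon.flatten_le_of_lt {l b : List D} (hl : IsLyndon l) {m : List (List D)}
    (hm : ∀ a ∈ m, a ≤ l) (hb0 : b ≠ []) (hb : b < l) : (b :: m).flatten ≤ l := by
  rw [List.flatten_cons]
  by_cases hpre : b <+: l
  · obtain ⟨t, rfl⟩ := hpre
    refine append_le_append_left_iff.2 (hl.flatten_le_suffix hm hb0 ?_ rfl)
    rintro rfl
    simp at hb
  · exact (append_lt_of_lt_of_not_prefix hb hpre _).le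

/-- If all suffixes `s` of `l` are not smaller than `v` (up to the case where `v` extends `l`
itself), concatenation is the largest shuffle of `l` and `v`. -/
theorem le_append_of_mem_shuffles {l v : List D}
    (hsuff : ∀ p s, p ≠ [] → s ≠ [] → l = p ++ s → v ≤ s)
    (hself : v ≤ l ∨ ∃ t, v = l ++ t ∧ ∀ w ∈ shuffles l t, w ≤ l ++ t)
    {w : List D} (hw : w ∈ shuffles l v) : w ≤ l ++ v := by
  have key : ∀ s p w, l = p ++ s → w ∈ shuffles s v → w ≤ s ++ v := by
    intro s
    induction s with
    | nil => intro p w _ hw; simp_all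
    | cons x s ih =>
      intro p w hps hw
      have ih' := fun w hw => ih (p ++ [x]) w (by simp [hps]) hw
      cases v with
      | nil => simp_all
      | cons y v =>
        rcases mem_shuffles_cons_cons.1 hw with ⟨w', hw', rfl⟩ | ⟨w', hw', rfl⟩
        · exact cons_le_cons_self_iff.2 (ih' _ hw')
        · have hyx : y < x ∨ y = x ∧ (v ≤ s ∨ ∃ t, v = s ++ t ∧
              ∀ w ∈ shuffles ([x] ++ s) t, w ≤ [x] ++ (s ++ t)) := by
            have hc : y :: v ≤ x :: s ∨ ∃ t, y :: v = x :: s ++ t ∧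
                ∀ w ∈ shuffles (x :: s) t, w ≤ x :: s ++ t := by
              by_cases hp : p = []
              · subst hp
                rw [List.nil_append] at hps
                rwa [hps] at hself
              · exact Or.inl (hsuff p _ hp (by simp) hps)
            rcases hc with h | ⟨t, ht, H⟩
            · rcases h.lt_or_eq with h | h
              · rcases List.cons_lt_cons_iff.1 h with h | ⟨h, h'⟩
                · exact Or.inl h
                · exact Or.inr ⟨h, Or.inl h'.le⟩
              · cases h; exact Or.inr ⟨rfl, Or.inl le_rfl⟩
            · cases ht
              exact Or.inr ⟨rfl, Or.inr ⟨t, rfl, H⟩⟩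
          rcases hyx with hyx | ⟨rfl, hyx⟩
          · exact cons_le_cons_of_lt hyx _ _
          -- Exchange with the one-letter prefix `[x]`: the tail is dominated by a shuffle of `s`
          -- with the whole second word, to which the induction on `s` applies.
          · obtain ⟨w'', h1, h2⟩ := exists_le_mem_shuffles_append hyx hw'
            exact cons_le_cons_self_iff.2 (h2.trans (ih' _ h1))
  exact key l [] w rfl hw

/-- If the first factor of `m` is below `l`, the whole concatenation is at most `l`. If it equals
`l`, the concatenation extends `l`, and the induction hypothesis supplies the remaining alternative
of `le_append_of_mem_shuffles`. -/
theorem IsLyndon.le_of_mem_shuffles {l : List D} (hl : IsLyndon l) {m : List (List D)}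
    (hm0 : ∀ a ∈ m, a ≠ []) (hm : ∀ a ∈ m, a ≤ l) {w : List D}
    (hw : w ∈ shuffles l m.flatten) : w ≤ l ++ m.flatten := by
  induction m generalizing w with
  | nil => simp_all
  | cons b m ih =>
    have hm' : ∀ a ∈ m, a ≤ l := fun a ha => hm a (by simp [ha])
    refine le_append_of_mem_shuffles (fun p s hp hs h => hl.flatten_le_suffix hm hp hs h) ?_ hw
    rcases (hm b (by simp)).lt_or_eq with hb | rfl
    · exact Or.inl (hl.flatten_le_of_lt hm' (hm0 b (by simp)) hb)
    · exact Or.inr ⟨m.flatten, rfl, fun w hw => ih (fun a ha => hm0 a (by simp [ha])) hm' hw⟩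

/-! ### Lyndon factorization. -/

/-- A nonincreasing sequence of Lyndon words. -/
def IsLyndonSeq (m : List (List D)) : Prop :=
  (∀ a ∈ m, IsLyndon a) ∧ m.Pairwise (· ≥ ·)

theorem IsLyndon.le_suffix {l : List D} (hl : IsLyndon l) {p s : List D} (hs : s ≠ [])
    (h : l = p ++ s) : l ≤ s := by
  by_cases hp : p = []
  · simp [h, hp]
  · exact (hl.2 p s hp hs h).le

/-- The last factor of a nonincreasing Lyndon factorization is the smallest nonempty suffix. -/
theorem IsLyndonSeq.last_le_suffix {m : List (List D)} {a : List D}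
    (h : IsLyndonSeq (m ++ [a])) {p s : List D} (hs : s ≠ [])
    (e : (m ++ [a]).flatten = p ++ s) : a ≤ s := by
  induction m generalizing p with
  | nil => exact (h.1 a (by simp)).le_suffix hs (by simpa using e)
  | cons b m ih =>
    have hm : IsLyndonSeq (m ++ [a]) :=
      ⟨fun c hc => h.1 c (by simp at hc ⊢; tauto), h.2.of_cons⟩
    rw [List.cons_append, List.flatten_cons] at e
    rcases List.append_eq_append_iff.1 e with ⟨q, hq, hq'⟩ | ⟨q, hq, hq'⟩
    · exact ih hm hq'
    · by_cases hq0 : q = []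
      · subst hq0
        exact ih hm (p := []) (by simpa using hq'.symm)
      · have hab : a ≤ b := List.rel_of_pairwise_cons h.2 (by simp)
        rw [hq']
        exact (hab.trans ((h.1 b (by simp)).le_suffix hq0 hq)).trans (le_append_self _ _)

/-- The last factor is determined as the smallest nonempty suffix; cancel it and recurse. -/
theorem IsLyndonSeq.eq_of_flatten_eq {m m' : List (List D)} (h : IsLyndonSeq m)
    (h' : IsLyndonSeq m') (e : m.flatten = m'.flatten) : m = m' := by
  induction m using List.reverseRecOn generalizing m' with
  | nil =>
    symm
    rw [List.eq_nil_iff_forall_not_mem]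
    intro a ha
    exact (h'.1 a ha).1 (List.flatten_eq_nil_iff.1 e.symm a ha)
  | append_singleton m a ih =>
    rcases m'.eq_nil_or_concat with rfl | ⟨m', b, rfl⟩
    · exact absurd (List.flatten_eq_nil_iff.1 e a (by simp)) (h.1 a (by simp)).1
    · rw [List.concat_eq_append] at *
      have ha : a ≤ b := h.last_le_suffix (p := m'.flatten) (h'.1 b (by simp)).1 (by simp [e])
      have hb : b ≤ a := h'.last_le_suffix (p := m.flatten) (h.1 a (by simp)).1 (by simp [← e])
      obtain rfl := le_antisymm ha hb
      rw [ih ⟨fun c hc => h.1 c (by simp [hc]), (List.pairwise_append.1 h.2).1⟩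
        (m' := m') ⟨fun c hc => h'.1 c (by simp [hc]), (List.pairwise_append.1 h'.2).1⟩
        (by simpa using e)]

theorem exists_min_suffix (w : List D) (hw : w ≠ []) :
    ∃ p s, w = p ++ s ∧ s ≠ [] ∧ ∀ q t, w = q ++ t → t ≠ [] → s ≤ t := by
  obtain ⟨s, hs, hmin⟩ := (w.tails.toFinset.filter (· ≠ [])).exists_min_image id
    ⟨w, by simp [hw]⟩
  simp only [Finset.mem_filter, List.mem_toFinset, List.mem_tails, id] at hs hmin
  obtain ⟨⟨p, hp⟩, hs0⟩ := hs
  exact ⟨p, s, hp.symm, hs0, fun q t h ht => hmin t ⟨⟨q, h.symm⟩, ht⟩⟩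

/-- Existence of the nonincreasing Lyndon factorization of a word. -/
theorem exists_isLyndonSeq (w : List D) : ∃ m, IsLyndonSeq m ∧ m.flatten = w := by
  induction hn : w.length using Nat.strong_induction_on generalizing w with
  | _ n ih =>
    by_cases hw : w = []
    · exact ⟨[], ⟨by simp, List.Pairwise.nil⟩, by simp [hw]⟩
    -- Split off the smallest nonempty suffix `s`, which minimality makes Lyndon, and factor the
    -- rest.
    · obtain ⟨p, s, hps, hs, hmin⟩ := exists_min_suffix w hw
      obtain ⟨m, hm, hmp⟩ := ih p.length (by
        have := List.length_pos_iff.2 hs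
        simp [hps] at hn; omega) p rfl
      have hsL : IsLyndon s := by
        refine ⟨hs, fun u v hu hv e => lt_of_le_of_ne ?_ ?_⟩
        · exact hmin (p ++ u) v (by simp [hps, e]) hv
        · intro h
          rw [h] at e
          exact hu (by simpa using e)
      refine ⟨m ++ [s], ⟨?_, ?_⟩, by simp [hmp, hps]⟩
      · intro a ha
        rcases List.mem_append.1 ha with ha | ha
        · exact hm.1 a ha
        · rw [List.mem_singleton.1 ha]; exact hsL
      · rcases m.eq_nil_or_concat with rfl | ⟨m, a, rfl⟩
        · simp
        · rw [List.concat_eq_append] at *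
          have hsa : s ≤ a := by
            by_contra! has
            have h1 : s ≤ a ++ s := hmin m.flatten _ (by simp [hps, ← hmp]) (by simp [hs])
            by_cases hpre : a <+: s
            -- With `s = a ++ t`, minimality gives both `s ≤ t` and `t ≤ s`, which forces `a` to be
            -- empty.
            · obtain ⟨t, rfl⟩ := hpre
              have ht : t ≠ [] := by rintro rfl; simp at has
              have h2 := hmin (p ++ a) t (by simp [hps]) ht
              have h3 := append_le_append_left_iff.1 h1
              have h4 := congrArg List.length (le_antisymm h2 h3)
              exact (hm.1 a (by simp)).1 (by simpa using h4)
            · exact absurd (append_lt_of_lt_of_not_prefix has hpre s) (not_lt.2 h1)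
          refine List.pairwise_append.2 ⟨hm.2, by simp, ?_⟩
          intro b hb c hc
          rw [List.mem_singleton.1 hc]
          rcases List.mem_append.1 hb with hb | hb
          · exact hsa.trans ((List.pairwise_append.1 hm.2).2.2 b hb a (by simp))
          · rwa [List.mem_singleton.1 hb]

/-- The list, with multiplicities, of all shuffles of a sequence of words. -/
def shuffleAll {D : Type*} : List (List D) → List (List D)
  | [] => [[]]
  | l :: m => (shuffleAll m).flatMap (shuffles l)

theorem flatten_mem_shuffleAll {D : Type*} (m : List (List D)) : m.flatten ∈ shuffleAll m := by
  induction m with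
  | nil => simp [shuffleAll]
  | cons l m ih => exact List.mem_flatMap.2 ⟨_, ih, append_mem_shuffles _ _⟩

theorem perm_of_mem_shuffleAll {D : Type*} {m : List (List D)} {w : List D}
    (h : w ∈ shuffleAll m) : w.Perm m.flatten := by
  induction m generalizing w with
  | nil => simp_all [shuffleAll]
  | cons l m ih =>
    obtain ⟨v, hv, hw⟩ := List.mem_flatMap.1 h
    exact (perm_of_mem_shuffles hw).trans ((ih hv).append_left l)

/-- By strict monotonicity of shuffling at fixed length, a nonmaximal shuffle of the tail may be
replaced by the concatenation of the tail. -/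
theorem IsLyndonSeq.le_of_mem_shuffleAll {m : List (List D)} (hm : IsLyndonSeq m) {w : List D}
    (h : w ∈ shuffleAll m) : w ≤ m.flatten := by
  induction m generalizing w with
  | nil => simp_all [shuffleAll]
  | cons l m ih =>
    obtain ⟨v, hv, hw⟩ := List.mem_flatMap.1 h
    have hm' : IsLyndonSeq m := ⟨fun c hc => hm.1 c (by simp [hc]), hm.2.of_cons⟩
    have key : ∀ w ∈ shuffles l m.flatten, w ≤ l ++ m.flatten := fun w hw =>
      (hm.1 l (by simp)).le_of_mem_shuffles (fun a ha => (hm'.1 a ha).1)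
        (fun a ha => List.rel_of_pairwise_cons hm.2 ha) hw
    rcases (ih hm' hv).lt_or_eq with hlt | rfl
    · obtain ⟨w', hw', hlt'⟩ :=
        exists_lt_mem_shuffles (perm_of_mem_shuffleAll hv).length_eq hlt hw
      exact hlt'.le.trans (key _ hw')
    · exact key _ hw

end Combinatorics

/-! ### The shuffle algebra and its functoriality. -/

section ShuffleAlgebra

variable {K : Type*} [Field K] {V : Type*} [AddCommGroup V] [Module K V]

theorem shuffle_comm (a b : TensorAlgebra K V) : shuffle a b = shuffle b a := by
  induction a using left_induction generalizing b with
  | h1 => simp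
  | hadd a a' ha ha' => simp [ha, ha']
  | hsmul c a ha => simp [ha]
  | hmul x a ha =>
    induction b using left_induction with
    | h1 => simp
    | hadd b b' hb hb' => simp [hb, hb']
    | hsmul c b hb => simp [hb]
    | hmul y b hb => rw [ι_mul_shuffle_ι_mul, ι_mul_shuffle_ι_mul, hb, ha, add_comm]

/-- The sum stays unexpanded in the last term so that, in `shuffle_assoc`, it folds back into a
shuffle product. -/
theorem add_shuffle_ι_mul (x y z : V) (p q c : TensorAlgebra K V) :
    shuffle (TensorAlgebra.ι K x * p + TensorAlgebra.ι K y * q) (TensorAlgebra.ι K z * c) =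
      TensorAlgebra.ι K x * shuffle p (TensorAlgebra.ι K z * c) +
      TensorAlgebra.ι K y * shuffle q (TensorAlgebra.ι K z * c) +
      TensorAlgebra.ι K z * shuffle (TensorAlgebra.ι K x * p + TensorAlgebra.ι K y * q) c := by
  simp only [map_add, LinearMap.add_apply, ι_mul_shuffle_ι_mul, mul_add]
  abel

theorem ι_mul_shuffle_add (x y z : V) (a p q : TensorAlgebra K V) :
    shuffle (TensorAlgebra.ι K x * a) (TensorAlgebra.ι K y * p + TensorAlgebra.ι K z * q) =
      TensorAlgebra.ι K x * shuffle a (TensorAlgebra.ι K y * p + TensorAlgebra.ι K z * q) +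
      TensorAlgebra.ι K y * shuffle (TensorAlgebra.ι K x * a) p +
      TensorAlgebra.ι K z * shuffle (TensorAlgebra.ι K x * a) q := by
  simp only [map_add, ι_mul_shuffle_ι_mul, mul_add]
  abel

theorem shuffle_assoc (a b c : TensorAlgebra K V) :
    shuffle (shuffle a b) c = shuffle a (shuffle b c) := by
  induction a using left_induction generalizing b c with
  | h1 => simp
  | hadd a a' ha ha' => simp [ha, ha']
  | hsmul r a ha => simp [ha]
  | hmul x a ha =>
    induction b using left_induction generalizing c with
    | h1 => simp
    | hadd b b' hb hb' => simp [hb, hb']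
    | hsmul r b hb => simp [hb]
    | hmul y b hb =>
      induction c using left_induction with
      | h1 => simp
      | hadd c c' hc hc' => simp [hc, hc']
      | hsmul r c hc => simp [hc]
      | hmul z c hc =>
        rw [ι_mul_shuffle_ι_mul x y, add_shuffle_ι_mul, ← ι_mul_shuffle_ι_mul x y,
          ι_mul_shuffle_ι_mul y z, ι_mul_shuffle_add, ← ι_mul_shuffle_ι_mul y z, ha, hb, hc]

/-- The algebra morphism `T(V) → T(V')` induced by a linear map. -/
def tensorMap {V' : Type*} [AddCommGroup V'] [Module K V'] (φ : V →ₗ[K] V') :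
    TensorAlgebra K V →ₐ[K] TensorAlgebra K V' :=
  TensorAlgebra.lift K (TensorAlgebra.ι K ∘ₗ φ)

section Map

variable {V' : Type*} [AddCommGroup V'] [Module K V'] (φ : V →ₗ[K] V')

@[simp]
theorem tensorMap_ι (x : V) :
    tensorMap φ (TensorAlgebra.ι K x) = TensorAlgebra.ι K (φ x) := by
  simp [tensorMap]

theorem tensorMap_shuffle (a b : TensorAlgebra K V) :
    tensorMap φ (shuffle a b) = shuffle (tensorMap φ a) (tensorMap φ b) := by
  induction a using left_induction generalizing b with
  | h1 => simp
  | hadd a a' ha ha' => simp [ha, ha']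
  | hsmul c a ha => simp [ha]
  | hmul x a ha =>
    induction b using left_induction with
    | h1 => simp
    | hadd b b' hb hb' => simp [hb, hb']
    | hsmul c b hb => simp [hb]
    | hmul y b hb => simp [ι_mul_shuffle_ι_mul, hb, ha] at hb ⊢

/-- Each term of a `•` product contains a letter in the image of `f`. -/
theorem tensorMap_bullet {f : V →ₗ[K] V} (hf : φ ∘ₗ f = 0) (a b : TensorAlgebra K V) :
    tensorMap φ (bullet f a b) = 0 := by
  induction a using left_induction with
  | h1 => simp
  | hadd a a' ha ha' => simp [ha, ha']
  | hsmul c a ha => simp [ha]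
  | hmul x a ha =>
    have hx : φ (f x) = 0 := LinearMap.congr_fun hf x
    simp [ι_mul_bullet, ha, hx]

end Map

variable {D : Type*} (x : D → V)

@[simp]
theorem word_nil : word (K := K) x [] = 1 := by
  simp [word]

@[simp]
theorem word_cons (d : D) (l : List D) :
    word (K := K) x (d :: l) = TensorAlgebra.ι K (x d) * word x l := by
  simp [word]

@[simp]
theorem word_append (l l' : List D) :
    word (K := K) x (l ++ l') = word x l * word x l' := by
  simp [word]

theorem tensorMap_word {V' : Type*} [AddCommGroup V'] [Module K V'] (φ : V →ₗ[K] V')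
    (l : List D) : tensorMap φ (word x l) = word (φ ∘ x) l := by
  induction l with
  | nil => simp
  | cons d l ih => simp [ih]

theorem shuffle_word (u v : List D) :
    shuffle (word (K := K) x u) (word x v) = ((shuffles u v).map (word x)).sum := by
  induction u generalizing v with
  | nil => simp
  | cons a u ihu =>
    induction v with
    | nil => simp
    | cons b v ihv =>
      rw [word_cons, word_cons, ι_mul_shuffle_ι_mul, ← word_cons, ← word_cons, ihu, ihv,
        shuffles_cons_cons, List.map_append, List.sum_append, List.map_map, List.map_map,
        ← List.sum_map_mul_left, ← List.sum_map_mul_left]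
      simp [Function.comp_def]

/-- The shuffle product of a sequence of words. -/
def shuffleProd (m : List (List D)) : TensorAlgebra K V :=
  m.foldr (fun l a => shuffle (word x l) a) 1

@[simp]
theorem shuffleProd_nil : shuffleProd (K := K) x [] = 1 := rfl

@[simp]
theorem shuffleProd_cons (l : List D) (m : List (List D)) :
    shuffleProd (K := K) x (l :: m) = shuffle (word x l) (shuffleProd x m) := rfl

theorem shuffleProd_append (m m' : List (List D)) :
    shuffleProd (K := K) x (m ++ m') = shuffle (shuffleProd x m) (shuffleProd x m') := by
  induction m with
  | nil => simp
  | cons l m ih => simp [ih, shuffle_assoc]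

theorem shuffleProd_perm {m m' : List (List D)} (h : m.Perm m') :
    shuffleProd (K := K) x m = shuffleProd x m' := by
  induction h with
  | nil => rfl
  | cons l _ ih => simp [ih]
  | swap l l' m =>
    simp only [shuffleProd_cons]
    rw [← shuffle_assoc, shuffle_comm (word x l'), shuffle_assoc]
  | trans _ _ ih ih' => exact ih.trans ih'

theorem shuffleProd_eq_sum (m : List (List D)) :
    shuffleProd (K := K) x m = ((shuffleAll m).map (word x)).sum := by
  induction m with
  | nil => simp [shuffleAll]
  | cons l m ih =>
    rw [shuffleProd_cons, ih, shuffleAll]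
    generalize shuffleAll m = L
    induction L with
    | nil => simp
    | cons v L ihL => simp [ihL, shuffle_word]

end ShuffleAlgebra

/-! ### Radford's theorem. -/

section Radford

variable {K : Type*} [Field K] {V : Type*} [AddCommGroup V] [Module K V] {D : Type*}

theorem sum_map_sub_count_smul_mem {R M ι : Type*} [Ring R] [AddCommGroup M] [Module R M]
    [BEq ι] [LawfulBEq ι] (A : Submodule R M) (F : ι → M) (i : ι) (L : List ι)
    (h : ∀ j ∈ L, j ≠ i → F j ∈ A) : (L.map F).sum - (L.count i : R) • F i ∈ A := by
  induction L with
  | nil => simp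
  | cons j L ih =>
    have ih' := ih fun k hk => h k (by simp [hk])
    by_cases hj : j = i
    · subst hj
      convert ih' using 1
      simp [add_smul]
      abel
    · convert A.add_mem (h j (by simp) hj) ih' using 1
      simp [hj]
      abel

variable [LinearOrder D]

/-- Radford's theorem: a shuffle subalgebra containing the empty word and the Lyndon words
contains all words. -/
theorem word_mem_of_lyndon [CharZero K] (x : D → V) (A : Submodule K (TensorAlgebra K V))
    (hS : emptyAndLyndonWords K x ⊆ A) (hA : ∀ a ∈ A, ∀ b ∈ A, shuffle a b ∈ A)
    (w : List D) : word x w ∈ A := by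
  have hprod : ∀ m : List (List D), (∀ a ∈ m, IsLyndon a) → shuffleProd x m ∈ A := by
    intro m hm
    induction m with
    | nil => exact hS (Or.inl rfl)
    | cons l m ih =>
      exact hA _ (hS (Or.inr ⟨l, hm l (by simp), rfl⟩)) _ (ih fun a ha => hm a (by simp [ha]))
  -- The lexicographic order need not be well founded, but shuffling only permutes letters, so the
  -- induction stays in a finite set.
  have hfin : {u : List D | u.Perm w}.Finite :=
    (w.permutations.toFinset.finite_toSet).subset fun u hu => by simpa using hu
  have hwf := hfin.wellFoundedOn (r := (· < ·))
  suffices ∀ u ∈ {u : List D | u.Perm w}, word x u ∈ A from this w (List.Perm.refl w)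
  intro u hu
  refine hwf.induction (P := fun u => word x u ∈ A) hu fun u hu ih => ?_
  obtain ⟨m, hm, rfl⟩ := exists_isLyndonSeq u
  have h := sum_map_sub_count_smul_mem A (word x) m.flatten (shuffleAll m) fun v hv hne =>
    ih v ((perm_of_mem_shuffleAll hv).trans hu)
      (lt_of_le_of_ne (hm.le_of_mem_shuffleAll hv) hne)
  rw [← shuffleProd_eq_sum] at h
  have h' := (A.sub_mem_iff_right (hprod m hm.1)).1 h
  have hc : (((shuffleAll m).count m.flatten : ℕ) : K) ≠ 0 :=
    Nat.cast_ne_zero.2 (List.count_pos_iff.2 (flatten_mem_shuffleAll m)).ne'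
  exact (A.smul_mem_iff hc).1 h'

end Radford

/-! ### Independence of Lyndon shuffle products. -/

section Independence

variable {K : Type*} [Field K] {V : Type*} [AddCommGroup V] [Module K V] {D : Type*}

theorem basis_tensorAlgebra_apply (b : Module.Basis D K V) (u : List D) :
    b.tensorAlgebra (FreeMonoid.ofList u) = word b u := by
  have h : ∀ u : List D, FreeAlgebra.basisFreeMonoid K D (FreeMonoid.ofList u) =
      (u.map (FreeAlgebra.ι K)).prod := by
    intro u
    rw [FreeAlgebra.basisFreeMonoid, Module.Basis.map_apply, Finsupp.coe_basisSingleOne]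
    change MonoidAlgebra.lift K (FreeAlgebra K D) (FreeMonoid D) (FreeMonoid.lift (FreeAlgebra.ι K))
      (MonoidAlgebra.single (FreeMonoid.ofList u) 1) = _
    rw [MonoidAlgebra.lift_single, one_smul, FreeMonoid.lift_ofList]
  rw [Module.Basis.tensorAlgebra, Module.Basis.map_apply, h]
  simp only [AlgEquiv.toLinearEquiv_apply, map_list_prod, List.map_map, word]
  congr 2
  ext d
  simp

theorem linearIndependent_word (b : Module.Basis D K V) :
    LinearIndependent K (word (K := K) b) := by
  have h := b.tensorAlgebra.linearIndependent.comp FreeMonoid.ofList FreeMonoid.ofList.injective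
  rwa [show b.tensorAlgebra ∘ FreeMonoid.ofList = word b from
    funext (basis_tensorAlgebra_apply b)] at h

variable [LinearOrder D]

/-- The span of the shuffle products of all Lyndon sequences but one. -/
def lyndonSpanNe (b : Module.Basis D K V) (m₀ : List (List D)) :
    Submodule K (TensorAlgebra K V) :=
  Submodule.span K (shuffleProd (K := K) b '' {m | IsLyndonSeq m ∧ m ≠ m₀})

/-- The concatenation of a Lyndon sequence is not a combination of the shuffle products
of the other ones. -/
theorem word_flatten_notMem_lyndonSpanNe [CharZero K] (b : Module.Basis D K V) {m₀ : List (List D)}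
    (hm₀ : IsLyndonSeq m₀) :
    word b m₀.flatten ∉ lyndonSpanNe (K := K) b m₀ := by
  let B : Module.Basis (List D) K (TensorAlgebra K V) :=
    b.tensorAlgebra.reindex FreeMonoid.toList
  have hB : ∀ u, B u = word b u := fun u => by
    simpa [B] using basis_tensorAlgebra_apply b u
  have hcoeff : ∀ m u, B.repr (shuffleProd b m) u = ((shuffleAll m).count u : K) := by
    intro m u
    rw [shuffleProd_eq_sum]
    generalize shuffleAll m = L
    induction L with
    | nil => simp
    | cons v L ih =>
      rw [List.map_cons, List.sum_cons, map_add, Finsupp.add_apply, ih, ← hB,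
        B.repr_self, List.count_cons, Finsupp.single_apply, add_comm]
      by_cases h : v = u <;> simp [h]
  intro hmem
  rw [lyndonSpanNe, Finsupp.mem_span_image_iff_linearCombination] at hmem
  obtain ⟨c, hc, hsum⟩ := hmem
  have hcs : ∀ m ∈ c.support, IsLyndonSeq m ∧ m ≠ m₀ := fun m hm => hc hm
  have hval : ∀ u, B.repr (word b m₀.flatten) u =
      ∑ m ∈ c.support, c m * ((shuffleAll m).count u : K) := by
    intro u
    rw [← hsum, Finsupp.linearCombination_apply, Finsupp.sum, map_sum, Finsupp.finsetSum_apply]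
    simp [hcoeff]
  rw [← hB] at hval
  simp only [B.repr_self] at hval
  rcases c.support.eq_empty_or_nonempty with he | hne
  · have := hval m₀.flatten
    simp [he] at this
  -- At the largest concatenation in the support only `m` contributes, with nonzero coefficient,
  -- while `word b m₀.flatten` has coefficient 0 there.
  · obtain ⟨m, hm, hmax⟩ := c.support.exists_max_image List.flatten hne
    have h := hval m.flatten
    rw [Finset.sum_eq_single_of_mem m hm, Finsupp.single_apply, if_neg] at h
    · refine mul_ne_zero (Finsupp.mem_support_iff.1 hm) ?_ h.symm
      exact Nat.cast_ne_zero.2 (List.count_pos_iff.2 (flatten_mem_shuffleAll m)).ne'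
    · exact fun e => (hcs m hm).2 ((hcs m hm).1.eq_of_flatten_eq hm₀ e.symm)
    · intro m' hm' hne'
      rw [List.count_eq_zero_of_not_mem, Nat.cast_zero, mul_zero]
      intro hmem
      have := (hcs m' hm').1.le_of_mem_shuffleAll hmem
      exact hne' ((hcs m' hm').1.eq_of_flatten_eq (hcs m hm).1 (le_antisymm (hmax m' hm') this))

theorem shuffleProd_mem_lyndonSpanNe (b : Module.Basis D K V) {m₀ m : List (List D)}
    (h₀ : m₀.length ≤ 1) (hm : ∀ a ∈ m, IsLyndon a) (hne : m ≠ m₀) :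
    shuffleProd b m ∈ lyndonSpanNe b m₀ := by
  have hp : (m.insertionSort (· ≥ ·)).Perm m := List.perm_insertionSort _ _
  refine Submodule.subset_span ⟨m.insertionSort (· ≥ ·), ⟨⟨?_, ?_⟩, ?_⟩, shuffleProd_perm _ hp⟩
  · exact fun a ha => hm a (hp.mem_iff.1 ha)
  · exact List.pairwise_insertionSort _ _
  · rintro rfl
    rcases m with - | ⟨a, - | ⟨a', m⟩⟩
    · simp at hne
    · simp at hne
    · have := hp.length_eq
      simp at h₀ this
      omega

/-- A sequence of length at most 1 is indecomposable: it is not the concatenation of two sequences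
both different from it. -/
theorem shuffle_mem_lyndonSpanNe (b : Module.Basis D K V) {m₀ : List (List D)}
    (h₀ : m₀.length ≤ 1) {p q : TensorAlgebra K V} (hp : p ∈ lyndonSpanNe b m₀)
    (hq : q ∈ lyndonSpanNe b m₀) : shuffle p q ∈ lyndonSpanNe b m₀ := by
  refine Submodule.span_induction₂ (p := fun p q _ _ => shuffle p q ∈ lyndonSpanNe b m₀)
    ?_ ?_ ?_ ?_ ?_ ?_ ?_ hp hq
  · rintro _ _ ⟨m, ⟨hm, hne⟩, rfl⟩ ⟨m', ⟨hm', hne'⟩, rfl⟩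
    rw [← shuffleProd_append]
    refine shuffleProd_mem_lyndonSpanNe b h₀ ?_ ?_
    · intro a ha
      rcases List.mem_append.1 ha with ha | ha
      exacts [hm.1 a ha, hm'.1 a ha]
    · rintro rfl
      rcases m with - | ⟨a, m⟩
      · simp at hne'
      · rcases m' with - | ⟨a', m'⟩
        · simp at hne
        · simp at h₀
  · simp
  · simp
  · intro a b c _ _ _ h h'
    simpa using Submodule.add_mem _ h h'
  · intro a b c _ _ _ h h'
    simpa using Submodule.add_mem _ h h'
  · intro r a b _ _ h
    simpa using Submodule.smul_mem _ r h
  · intro r a b _ _ h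
    simpa using Submodule.smul_mem _ r h

end Independence

/-! ### Generation by the pre-Lie product. -/

section Generators

variable {K : Type*} [Field K] {V : Type*} [AddCommGroup V] [Module K V]

theorem span_words_eq_top {E : Type*} (x : E → V) (hx : Submodule.span K (Set.range x) = ⊤) :
    Submodule.span K (words K x) = ⊤ := by
  refine eq_top_iff.2 fun a _ => ?_
  induction a using left_induction with
  | h1 => exact Submodule.subset_span ⟨[], word_nil x⟩
  | hadd a b ha hb => exact Submodule.add_mem _ (ha trivial) (hb trivial)
  | hsmul c a ha => exact Submodule.smul_mem _ c (ha trivial)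
  | hmul y a ha =>
    have hy : y ∈ Submodule.span K (Set.range x) := hx ▸ Submodule.mem_top
    have ha := ha trivial
    refine Submodule.span_induction₂
      (p := fun y a _ _ => TensorAlgebra.ι K y * a ∈ Submodule.span K (words K x))
      ?_ ?_ ?_ ?_ ?_ ?_ ?_ hy ha
    · rintro _ _ ⟨e, rfl⟩ ⟨l, rfl⟩
      exact Submodule.subset_span ⟨e :: l, word_cons x e l⟩
    · simp
    · simp
    · intro a b c _ _ _ h h'
      simpa [add_mul] using Submodule.add_mem _ h h'
    · intro a b c _ _ _ h h'
      simpa [mul_add] using Submodule.add_mem _ h h'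
    · intro r a b _ _ h
      simpa using Submodule.smul_mem _ r h
    · intro r a b _ _ h
      simpa using Submodule.smul_mem _ r h

/-- Unrolls the recursion of `•` along `p`; `q` collects the letters already passed. The term where
`f` hits the last letter `y` is isolated, and `H` absorbs the others. -/
theorem word_mul_bullet_sub_mem {D : Type*} (f : V →ₗ[K] V) (x : D → V)
    (M : Submodule K (TensorAlgebra K V)) (y : V) (b : TensorAlgebra K V) (p q : List D)
    (H : ∀ p₁ d p₂, p = p₁ ++ d :: p₂ → word x (q ++ p₁) *
      (TensorAlgebra.ι K (f (x d)) * shuffle (word x p₂ * TensorAlgebra.ι K y) b) ∈ M) :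
    word x q * (bullet f (word x p * TensorAlgebra.ι K y) b -
      word x p * (TensorAlgebra.ι K (f y) * b)) ∈ M := by
  induction p generalizing q with
  | nil =>
    have h := ι_mul_bullet f y 1 b
    simp only [mul_one, one_bullet, mul_zero, zero_add, one_shuffle] at h
    simp [h]
  | cons d p ih =>
    have h1 := ih (q ++ [d]) fun p₁ e p₂ he => by
      simpa using H (d :: p₁) e p₂ (by simp [he])
    have h2 := H [] d p rfl
    convert M.add_mem h1 h2 using 1
    rw [word_cons, mul_assoc, ι_mul_bullet]
    simp only [word_append, word_cons, word_nil, mul_one, List.append_nil]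
    noncomm_ring

theorem eq_map_zero_or_exists_succ {E : Type*} (l : List (ℕ × E)) :
    (∃ u : List E, l = u.map (Prod.mk 0)) ∨
      ∃ (u : List E) (k : ℕ) (e : E) (l' : List (ℕ × E)),
        l = u.map (Prod.mk 0) ++ (k + 1, e) :: l' := by
  induction l with
  | nil => exact Or.inl ⟨[], rfl⟩
  | cons a l ih =>
    obtain ⟨k, e⟩ := a
    cases k with
    | succ k => exact Or.inr ⟨[], k, e, l, rfl⟩
    | zero =>
      rcases ih with ⟨u, rfl⟩ | ⟨u, k, e', l', rfl⟩
      · exact Or.inl ⟨e :: u, rfl⟩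
      · exact Or.inr ⟨e :: u, k, e', l', rfl⟩

theorem sum_fst_map_zero {E : Type*} (u : List E) :
    ((u.map (Prod.mk 0)).map (Prod.fst : ℕ × E → ℕ)).sum = 0 := by
  induction u with
  | nil => rfl
  | cons e u ih => simpa using ih

theorem word_mem_of_bullet_closed {E : Type*} (f : V →ₗ[K] V) (x : ℕ × E → V)
    (hx : ∀ k e, f (x (k, e)) = x (k + 1, e)) (A : Submodule K (TensorAlgebra K V))
    (h0 : ∀ u : List E, word x (u.map (Prod.mk 0)) ∈ A)
    (hA : ∀ a ∈ A, ∀ b ∈ A, bullet f a b ∈ A) (l : List (ℕ × E)) : word x l ∈ A := by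
  induction hn : (l.map Prod.fst).sum using Nat.strong_induction_on generalizing l with
  | _ n ih =>
    have aux : ∀ (j : ℕ) (u : List E), u.length = j → ∀ k e (l' : List (ℕ × E)),
        k + 1 + (l'.map Prod.fst).sum = n →
        word x (u.map (Prod.mk 0) ++ (k + 1, e) :: l') ∈ A := by
      intro j
      induction j using Nat.strong_induction_on with
      | _ j ihj =>
        intro u hu k e l' hl'
        have hb : bullet f (word x (u.map (Prod.mk 0)) * TensorAlgebra.ι K (x (k, e)))
            (word x l') ∈ A := by
          refine hA _ ?_ _ (ih _ (by omega) l' rfl)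
          have := ih k (by omega) (u.map (Prod.mk 0) ++ [(k, e)]) (by
            rw [List.map_append, List.sum_append, sum_fst_map_zero]; simp)
          simpa using this
        have key := word_mul_bullet_sub_mem f x A (x (k, e)) (word x l') (u.map (Prod.mk 0)) []
          (by
            -- Here `f` hits an earlier letter: the total exponent is still `n`, but the initial
            -- block of exponent 0 shrinks to `u₁`.
            intro p₁ d p₂ hp
            obtain ⟨u₁, u', rfl, rfl, h2⟩ := List.map_eq_append_iff.1 hp
            obtain ⟨e₁, u₂, rfl, rfl, rfl⟩ := List.map_eq_cons_iff.1 h2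
            have hw : word (K := K) x (u₂.map (Prod.mk 0)) * TensorAlgebra.ι K (x (k, e)) =
                word x (u₂.map (Prod.mk 0) ++ [(k, e)]) := by simp
            rw [hw, shuffle_word, hx, ← List.sum_map_mul_left, ← List.sum_map_mul_left]
            refine list_sum_mem ?_
            simp only [List.mem_map]
            rintro _ ⟨s, hs, rfl⟩
            have := ihj u₁.length (by simp at hu; omega) u₁ rfl 0 e₁ s (by
              rw [((perm_of_mem_shuffles hs).map Prod.fst).sum_eq, List.map_append,
                List.map_append, List.sum_append, List.sum_append, sum_fst_map_zero]
              simp; omega)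
            simpa using this)
        rw [word_nil, one_mul, hx] at key
        simpa using (A.sub_mem_iff_right hb).1 key
    rcases eq_map_zero_or_exists_succ l with ⟨u, rfl⟩ | ⟨u, k, e, l', rfl⟩
    · exact h0 u
    · refine aux _ u rfl k e l' ?_
      rw [← hn, List.map_append, List.sum_append, sum_fst_map_zero]
      simp

theorem eq_top_of_bullet_closed {E : Type*} (f : V →ₗ[K] V) (x : ℕ × E → V)
    (hx : ∀ k e, f (x (k, e)) = x (k + 1, e)) (hspan : Submodule.span K (Set.range x) = ⊤)
    (A : Submodule K (TensorAlgebra K V)) (h0 : ∀ u : List E, word (fun e => x (0, e)) u ∈ A)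
    (hA : ∀ a ∈ A, ∀ b ∈ A, bullet f a b ∈ A) : A = ⊤ := by
  rw [eq_top_iff, ← span_words_eq_top x hspan, Submodule.span_le]
  rintro _ ⟨l, rfl⟩
  refine word_mem_of_bullet_closed f x hx A (fun u => ?_) hA l
  simpa [word, Function.comp_def] using h0 u

theorem preLieAdjoin_tensorSubspace (g : V →ₗ[K] V) (W : Submodule K V)
    (h : (⨆ n : ℕ, W.map (g ^ n)) = ⊤) : preLieAdjoin g (tensorSubspace W) = ⊤ := by
  refine sInf_eq_top.2 ?_
  rintro A ⟨hS, hA⟩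
  -- All vectors of `W` serve as letters, since spanning suffices.
  refine eq_top_of_bullet_closed g (fun p : ℕ × W => (g ^ p.1) p.2) ?_ ?_ A ?_ hA
  · intro k e
    simp [pow_succ']
  · rw [eq_top_iff, ← h, iSup_le_iff]
    rintro n _ ⟨w, hw, rfl⟩
    exact Submodule.subset_span ⟨(n, ⟨w, hw⟩), rfl⟩
  · intro u
    refine hS ⟨word (fun e : W => e) u, ?_⟩
    exact tensorMap_word _ W.subtype u

theorem comPreLieAdjoin_lyndon [CharZero K] (g : V →ₗ[K] V) (W : Submodule K V)
    (h : (⨆ n : ℕ, W.map (g ^ n)) = ⊤) {D : Type*} [LinearOrder D] (w : Module.Basis D K W) :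
    comPreLieAdjoin g (emptyAndLyndonWords K fun d => (w d : V)) = ⊤ := by
  refine sInf_eq_top.2 ?_
  rintro A ⟨hS, hA, hA'⟩
  refine eq_top_iff.2 ?_
  rw [← preLieAdjoin_tensorSubspace g W h]
  refine sInf_le ⟨?_, hA'⟩
  rintro _ ⟨t, rfl⟩
  have ht : t ∈ Submodule.span K (words K w) := by
    rw [span_words_eq_top w w.span_eq]; trivial
  change tensorMap W.subtype t ∈ A
  induction ht using Submodule.span_induction with
  | mem t ht =>
    obtain ⟨u, rfl⟩ := ht
    rw [tensorMap_word]
    exact word_mem_of_lyndon _ A hS hA u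
  | zero => simp
  | add a b _ _ ha hb => rw [map_add]; exact A.add_mem ha hb
  | smul c a _ ha => rw [map_smul]; exact A.smul_mem c ha

end Generators

/-! ### Minimality for biletters. -/

section Free

variable (K : Type*) [Field K] (D : Type*)

theorem biShift_single (k : ℕ) (d : D) :
    biShift K D (Finsupp.single (k, d) 1) = Finsupp.single (k + 1, d) 1 := by
  simp [biShift]

theorem eq_top_of_biShift_bullet_closed (A : Submodule K (TensorAlgebra K (BiSpace K D)))
    (h0 : ∀ u : List D, word (biletterZero K) u ∈ A)
    (hA : ∀ a ∈ A, ∀ b ∈ A, bullet (biShift K D) a b ∈ A) : A = ⊤ :=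
  eq_top_of_bullet_closed (biShift K D) (fun p => Finsupp.single p 1) (biShift_single K D)
    (by simpa using (Finsupp.basisSingleOne (R := K) (ι := ℕ × D)).span_eq) A h0 hA

/-- The projection of `V_D` on the span of the biletters `(0, d)`, which kills the image of
`f_D`. -/
def biProj : BiSpace K D →ₗ[K] D →₀ K :=
  Finsupp.linearCombination K fun p : ℕ × D => if p.1 = 0 then Finsupp.single p.2 1 else 0

theorem biProj_biletterZero :
    biProj K D ∘ biletterZero K = (Finsupp.basisSingleOne (R := K) (ι := D)) := by
  ext d : 1
  simp [biProj, biletterZero]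

theorem biProj_comp_biShift : biProj K D ∘ₗ biShift K D = 0 := by
  ext p : 2
  simp [biProj, biShift]

theorem tensorMap_biProj_word (u : List D) :
    tensorMap (biProj K D) (word (biletterZero K) u) =
      word (Finsupp.basisSingleOne (R := K) (ι := D)) u := by
  rw [tensorMap_word, biProj_biletterZero]

theorem minimal_preLie_words :
    Minimal (fun S => preLieAdjoin (biShift K D) S = ⊤)
      (words K (biletterZero K (D := D))) := by
  refine ⟨sInf_eq_top.2 fun A hA => ?_, fun S hS hle => ?_⟩
  · exact eq_top_of_biShift_bullet_closed K D A (fun u => hA.1 ⟨u, rfl⟩) hA.2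
  · rintro _ ⟨u, rfl⟩
    by_contra hu
    let b := Finsupp.basisSingleOne (R := K) (ι := D)
    -- If `u` is missing from `S`, everything generated projects into the span of the other words.
    let B := Submodule.span K (word (K := K) b '' {u}ᶜ)
    have hA : preLieAdjoin (biShift K D) S ≤ B.comap (tensorMap (biProj K D)).toLinearMap := by
      refine sInf_le ⟨fun s hs => ?_, fun a _ c _ => ?_⟩
      · obtain ⟨v, rfl⟩ := hle hs
        change tensorMap (biProj K D) (word (biletterZero K) v) ∈ B
        rw [tensorMap_biProj_word]
        exact Submodule.subset_span ⟨v, fun h => hu (h ▸ hs), rfl⟩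
      · change tensorMap (biProj K D) _ ∈ B
        rw [tensorMap_bullet _ (biProj_comp_biShift K D)]
        exact B.zero_mem
    rw [hS] at hA
    have hmem : tensorMap (biProj K D) (word (biletterZero K) u) ∈ B :=
      hA (Submodule.mem_top (x := word (biletterZero K) u))
    rw [tensorMap_biProj_word] at hmem
    exact (linearIndependent_word b).notMem_span_image (s := {u}ᶜ) (x := u) (by simp) hmem

theorem minimal_comPreLie_lyndon [CharZero K] [LinearOrder D] :
    Minimal (fun S => comPreLieAdjoin (biShift K D) S = ⊤)
      (emptyAndLyndonWords K (biletterZero K (D := D))) := by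
  refine ⟨sInf_eq_top.2 fun A hA => ?_, fun S hS hle => ?_⟩
  · exact eq_top_of_biShift_bullet_closed K D A
      (fun u => word_mem_of_lyndon _ A hA.1 hA.2.1 u) hA.2.2
  · let b := Finsupp.basisSingleOne (R := K) (ι := D)
    -- The empty word and the Lyndon words are treated together, as Lyndon sequences of length 0 and
    -- 1.
    have key : ∀ m₀ : List (List D), IsLyndonSeq m₀ → m₀.length ≤ 1 →
        word (biletterZero K) m₀.flatten ∈ S := by
      intro m₀ hm₀ hlen
      by_contra hmem
      have hA : comPreLieAdjoin (biShift K D) S ≤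
          (lyndonSpanNe b m₀).comap (tensorMap (biProj K D)).toLinearMap := by
        refine sInf_le ⟨fun s hs => ?_, fun p hp q hq => ?_, fun p _ q _ => ?_⟩
        · have hs' : ∃ m : List (List D), (∀ a ∈ m, IsLyndon a) ∧
              s = word (biletterZero K) m.flatten ∧
              shuffleProd b m = word (K := K) b m.flatten := by
            rcases hle hs with rfl | ⟨l, hl, rfl⟩
            · exact ⟨[], by simp, by simp, by simp⟩
            · refine ⟨[l], ?_, by simp, by simp⟩
              intro a ha
              rw [List.mem_singleton.1 ha]
              exact hl
          obtain ⟨m, hm, rfl, hprod⟩ := hs'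
          change tensorMap (biProj K D) _ ∈ lyndonSpanNe b m₀
          rw [tensorMap_biProj_word]
          change word (K := K) b m.flatten ∈ _
          rw [← hprod]
          exact shuffleProd_mem_lyndonSpanNe b hlen hm fun h => hmem (h ▸ hs)
        · change tensorMap (biProj K D) _ ∈ lyndonSpanNe b m₀
          rw [tensorMap_shuffle]
          exact shuffle_mem_lyndonSpanNe b hlen hp hq
        · change tensorMap (biProj K D) _ ∈ lyndonSpanNe b m₀
          rw [tensorMap_bullet _ (biProj_comp_biShift K D)]
          exact Submodule.zero_mem _
      rw [hS] at hA
      have h : tensorMap (biProj K D) (word (biletterZero K) m₀.flatten) ∈ lyndonSpanNe b m₀ :=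
        hA (Submodule.mem_top (x := word (biletterZero K) m₀.flatten))
      rw [tensorMap_biProj_word] at h
      exact word_flatten_notMem_lyndonSpanNe b hm₀ h
    rintro _ (rfl | ⟨l, hl, rfl⟩)
    · simpa using key [] ⟨by simp, List.Pairwise.nil⟩ (by simp)
    · have hl' : IsLyndonSeq [l] := ⟨fun a ha => by rw [List.mem_singleton.1 ha]; exact hl,
        List.pairwise_singleton _ _⟩
      simpa using key [l] hl' (by simp)

end Free

end ComPreLie

end

theorem mainTheorem6 {K : Type*} [Field K] [CharZero K] :
    (∀ (D : Type*) [LinearOrder D],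
      Minimal (fun S => ComPreLie.preLieAdjoin (ComPreLie.biShift K D) S = ⊤)
        (ComPreLie.words K (ComPreLie.biletterZero K (D := D))) ∧
      Minimal (fun S => ComPreLie.comPreLieAdjoin (ComPreLie.biShift K D) S = ⊤)
        (ComPreLie.emptyAndLyndonWords K (ComPreLie.biletterZero K (D := D)))) ∧
    (∀ (V : Type*) [AddCommGroup V] [Module K V] (g : V →ₗ[K] V) (W : Submodule K V),
      (⨆ n : ℕ, W.map (g ^ n)) = ⊤ →
        ComPreLie.preLieAdjoin g (ComPreLie.tensorSubspace W) = ⊤ ∧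
        ∀ (D : Type*) [LinearOrder D] (w : Module.Basis D K W),
          ComPreLie.comPreLieAdjoin g
            (ComPreLie.emptyAndLyndonWords K fun d => (w d : V)) = ⊤) := by
  refine ⟨fun D _ => ⟨ComPreLie.minimal_preLie_words K D,
    ComPreLie.minimal_comPreLie_lyndon K D⟩, fun V _ _ g W h => ?_⟩
  exact ⟨ComPreLie.preLieAdjoin_tensorSubspace g W h,
    fun D _ w => ComPreLie.comPreLieAdjoin_lyndon g W h w⟩
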